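/- Let $N=\mathbb{Z}^n$ with $n\ge 1$, let $M=\operatorname{Hom}(N,\mathbb{Z})$, and let $\Delta^*$ be a complete simplicial augmented fan in $N$: a finite complete simplicial fan $\Delta$ of strongly convex rational polyhedral cones in $N_{\mathbb{R}}$ together with a nonzero lattice point $n(\rho)\in N\cap\rho$ for every one-dimensional cone $\rho\in\Delta(1)$. Let $X=X_{\Delta^*}$ be the associated compact toric orbifold. Its underlying space is the toric variety $X_\Delta=\bigcup_{\sigma\in\Delta}\operatorname{Spec}\mathbb{C}[\sigma^\vee\cap M]$. Its uniformizing charts are, for the $n$-dimensional cones $\sigma\in\Delta$ with rays $\rho_1,\dots,\rho_n$ and $p_i=n(\rho_i)$, the maps $\mathbb{C}^n\to U_\sigma=\operatorname{Spec}\mathbb{C}[\sigma^\vee\cap M]$ sending $z$ to the point with $x^m=\prod_i z_i^{\langle m,p_i\rangle}$; they have the local uniformizing groups $N/\mathbb{Z}\{p_1,\dots,p_n\}$. Assume that $X$ is Fano, i.e. if $k:N_{\mathbb{R}}\to\mathbb{R}$ is the function that is linear on each cone of $\Delta$ with $k(n(\rho))=1$ for all $\rho\in\Delta(1)$, then $-k$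 is strictly upper convex: $-k$ is superadditive, and it is given by different linear functions on different $n$-dimensional cones. Assume also that $X$ is special symmetric, i.e. the group $\mathcal{W}_0(X)$ of all $\gamma\in GL(n,\mathbb{Z})$ that permute the cones of $\Delta$ and satisfy $n(\gamma\rho)=\gamma\,n(\rho)$ for all $\rho\in\Delta(1)$ contains the involution $n\mapsto -n$. Let $\mathbf{K}_X$ be the (orbifold) canonical V-bundle of $X$, i.e. the V-bundle of holomorphic $n$-forms. Then there is a largest positive integer $m$ for which there exists a (proper) holomorphic line V-bundle $\mathbf{L}$ on $X$ with $\mathbf{L}^m\cong\mathbf{K}_X^{-1}$, and this integer, the index $\operatorname{Ind}(X)$, is $1$ or $2$. -/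

import Mathlib

open Set Filter Topology Matrix

/-! ### Complex orbifolds given by uniformizing charts, and holomorphic line V-bundles

An (effective) complex orbifold of dimension `n` is given by a family of uniformizing maps
`φ i : ℂⁿ → X` onto pieces of the underlying space `X`.  Its changes of charts (Satake's
"injections") are the biholomorphic maps between open subsets of `ℂⁿ` that lie over the identity
of `X`; for `i = j` they include the elements of the local uniformizing groups. -/

/-- A change of charts from the uniformizing chart `φ i` to the uniformizing chart `φ j`: a
biholomorphic map between open subsets of `ℂⁿ` that commutes with the projections to `X`. -/
structure ChartChange {n : ℕ} {X ι : Type} (φ : ι → (Fin n → ℂ) → X) (i j : ι) where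
  toHomeo : OpenPartialHomeomorph (Fin n → ℂ) (Fin n → ℂ)
  holo : AnalyticOnNhd ℂ toHomeo toHomeo.source
  holo_symm : AnalyticOnNhd ℂ toHomeo.symm toHomeo.target
  proj_eq : ∀ x ∈ toHomeo.source, φ j (toHomeo x) = φ i x

/-- Composition of changes of charts, on the largest possible domain. -/
noncomputable def ChartChange.trans {n : ℕ} {X ι : Type} {φ : ι → (Fin n → ℂ) → X} {i j k : ι}
    (e : ChartChange φ i j) (e' : ChartChange φ j k) : ChartChange φ i k where
  toHomeo := e.toHomeo.trans e'.toHomeo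
  holo := by
    intro x hx
    simp only [OpenPartialHomeomorph.trans_source, mem_inter_iff, mem_preimage] at hx
    exact (e'.holo _ hx.2).comp (e.holo x hx.1)
  holo_symm := by
    intro x hx
    simp only [OpenPartialHomeomorph.trans_target, mem_inter_iff, mem_preimage] at hx
    exact (e.holo_symm _ hx.2).comp (e'.holo_symm x hx.1)
  proj_eq := by
    intro x hx
    simp only [OpenPartialHomeomorph.trans_source, mem_inter_iff, mem_preimage] at hx
    exact (e'.proj_eq _ hx.2).trans (e.proj_eq x hx.1)

/-- A (proper) holomorphic line V-bundle on the orbifold with uniformizing charts `φ`, in terms of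
local trivializations: every chart is covered by open sets `dom i a`, over which the bundle is
identified with `dom i a × ℂ`, and every change of charts `e` from `i` to `j` lifts to the bundle,
the lift being `(x, v) ↦ (e x, trans e a b x * v)` in the trivializations over `dom i a` and
`dom j b`.  The lift depends only on the germ of `e`, and lifts are compatible with composition. -/
structure LineVBundle {n : ℕ} {X ι : Type} (φ : ι → (Fin n → ℂ) → X) where
  κ : ι → Type
  dom : ∀ i, κ i → Set (Fin n → ℂ)
  isOpen_dom : ∀ i a, IsOpen (dom i a)
  cover : ∀ i x, ∃ a, x ∈ dom i a
  trans : ∀ {i j}, ChartChange φ i j → κ i → κ j → (Fin n → ℂ) → ℂ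
  holo : ∀ {i j} (e : ChartChange φ i j) (a : κ i) (b : κ j),
    AnalyticOnNhd ℂ (trans e a b)
      {x | x ∈ dom i a ∧ x ∈ e.toHomeo.source ∧ e.toHomeo x ∈ dom j b}
  ne_zero : ∀ {i j} (e : ChartChange φ i j) (a : κ i) (b : κ j) (x : Fin n → ℂ),
    x ∈ dom i a → x ∈ e.toHomeo.source → e.toHomeo x ∈ dom j b → trans e a b x ≠ 0
  germ : ∀ {i j} (e e' : ChartChange φ i j) (a : κ i) (b : κ j) (x : Fin n → ℂ),
    x ∈ dom i a → x ∈ e.toHomeo.source → x ∈ e'.toHomeo.source → e.toHomeo x ∈ dom j b →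
    (e.toHomeo : (Fin n → ℂ) → (Fin n → ℂ)) =ᶠ[𝓝 x] e'.toHomeo →
    trans e a b x = trans e' a b x
  cocycle : ∀ {i j k} (e : ChartChange φ i j) (e' : ChartChange φ j k)
    (a : κ i) (b : κ j) (c : κ k) (x : Fin n → ℂ),
    x ∈ dom i a → x ∈ e.toHomeo.source → e.toHomeo x ∈ dom j b →
    e.toHomeo x ∈ e'.toHomeo.source → e'.toHomeo (e.toHomeo x) ∈ dom k c →
    trans (e.trans e') a c x = trans e' b c (e.toHomeo x) * trans e a b x

namespace LineVBundle

variable {n : ℕ} {X ι : Type} {φ : ι → (Fin n → ℂ) → X}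

/-- Isomorphism of holomorphic line V-bundles: on every chart a bundle isomorphism, given in the
trivializations over `L.dom i a` and `L'.dom i b` by a nowhere vanishing holomorphic function
`u i a b`, that commutes with the lifts of all changes of charts. -/
def Iso (L L' : LineVBundle φ) : Prop :=
  ∃ u : ∀ i, L.κ i → L'.κ i → (Fin n → ℂ) → ℂ,
    (∀ i a b, AnalyticOnNhd ℂ (u i a b) (L.dom i a ∩ L'.dom i b)) ∧
    (∀ i a b, ∀ x ∈ L.dom i a ∩ L'.dom i b, u i a b x ≠ 0) ∧
    ∀ (i j : ι) (e : ChartChange φ i j) (a : L.κ i) (b : L.κ j) (a' : L'.κ i) (b' : L'.κ j),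
      ∀ x ∈ e.toHomeo.source, x ∈ L.dom i a → x ∈ L'.dom i a' →
        e.toHomeo x ∈ L.dom j b → e.toHomeo x ∈ L'.dom j b' →
        u j b b' (e.toHomeo x) * L.trans e a b x = L'.trans e a' b' x * u i a a' x

/-- The tensor power `L^m` of a line V-bundle. -/
noncomputable def pow (L : LineVBundle φ) (m : ℕ) : LineVBundle φ where
  κ := L.κ
  dom := L.dom
  isOpen_dom := L.isOpen_dom
  cover := L.cover
  trans e a b x := L.trans e a b x ^ m
  holo e a b := (L.holo e a b).pow m
  ne_zero e a b x h1 h2 h3 := pow_ne_zero m (L.ne_zero e a b x h1 h2 h3)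
  germ e e' a b x h1 h2 h3 h4 h5 := by rw [L.germ e e' a b x h1 h2 h3 h4 h5]
  cocycle e e' a b c x h1 h2 h3 h4 h5 := by
    rw [L.cocycle e e' a b c x h1 h2 h3 h4 h5, mul_pow]

/-- The dual `L⁻¹` of a line V-bundle. -/
noncomputable def dual (L : LineVBundle φ) : LineVBundle φ where
  κ := L.κ
  dom := L.dom
  isOpen_dom := L.isOpen_dom
  cover := L.cover
  trans e a b x := (L.trans e a b x)⁻¹
  holo e a b := (L.holo e a b).inv fun x hx => L.ne_zero e a b x hx.1 hx.2.1 hx.2.2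
  ne_zero e a b x h1 h2 h3 := inv_ne_zero (L.ne_zero e a b x h1 h2 h3)
  germ e e' a b x h1 h2 h3 h4 h5 := by rw [L.germ e e' a b x h1 h2 h3 h4 h5]
  cocycle e e' a b c x h1 h2 h3 h4 h5 := by
    rw [L.cocycle e e' a b c x h1 h2 h3 h4 h5, mul_inv]

theorem analyticOnNhd_det_fderiv (e : (Fin n → ℂ) → (Fin n → ℂ)) (s : Set (Fin n → ℂ))
    (he : AnalyticOnNhd ℂ e s) : AnalyticOnNhd ℂ (fun x => (fderiv ℂ e x).det) s := by
  have h : (fun x => (fderiv ℂ e x).det) =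
      fun x => ∑ σ : Equiv.Perm (Fin n), ((Equiv.Perm.sign σ : ℤ) : ℂ) *
        ∏ i, (fderiv ℂ e x) (Pi.single i 1) (σ i) := by
    funext x
    rw [ContinuousLinearMap.det, ← LinearMap.det_toMatrix', Matrix.det_apply']
    refine Finset.sum_congr rfl fun σ _ => ?_
    simp [LinearMap.toMatrix'_apply]
  rw [h]
  refine Finset.analyticOnNhd_fun_sum _ fun σ _ => ?_
  refine analyticOnNhd_const.mul ?_
  refine Finset.analyticOnNhd_fun_prod _ fun i _ => ?_
  intro x hx
  have h1 := he.fderiv x hx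
  have h2 := ((ContinuousLinearMap.proj (R := ℂ) (φ := fun _ : Fin n => ℂ) (σ i)).comp
    (ContinuousLinearMap.apply ℂ (Fin n → ℂ) (Pi.single i (1 : ℂ) : Fin n → ℂ))).analyticAt
    (fderiv ℂ e x)
  exact h2.comp (f := fun y => fderiv ℂ e y) h1

theorem det_fderiv_ne_zero {i j : ι} (e : ChartChange φ i j) (x : Fin n → ℂ)
    (hx : x ∈ e.toHomeo.source) : (fderiv ℂ e.toHomeo x).det ≠ 0 := by
  have h1 := (e.holo x hx).differentiableAt
  have h2 := (e.holo_symm _ (e.toHomeo.map_source hx)).differentiableAt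
  have h3 : (fun y => e.toHomeo.symm (e.toHomeo y)) =ᶠ[𝓝 x] id :=
    e.toHomeo.eventually_left_inverse hx
  have h4 := h3.fderiv_eq (𝕜 := ℂ)
  have h5 : fderiv ℂ (fun y => e.toHomeo.symm (e.toHomeo y)) x = _ := fderiv_comp x h2 h1
  rw [h5, fderiv_id] at h4
  intro h0
  have h6 := congrArg ContinuousLinearMap.det h4
  simp only [ContinuousLinearMap.det, ContinuousLinearMap.toLinearMap_comp,
    LinearMap.det_comp] at h6 h0
  rw [h0, mul_zero] at h6
  simp at h6

/-- The canonical V-bundle `K`, the V-bundle of holomorphic `n`-forms.  It is trivialized by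
`dz₁ ∧ ⋯ ∧ dzₙ` on every chart; a change of charts `e` carries the form with value
`v dz₁ ∧ ⋯ ∧ dzₙ` at `x` to the form with value `det (De x)⁻¹ v dz₁ ∧ ⋯ ∧ dzₙ` at `e x`. -/
noncomputable def canonical (φ : ι → (Fin n → ℂ) → X) : LineVBundle φ where
  κ _ := Unit
  dom _ _ := univ
  isOpen_dom _ _ := isOpen_univ
  cover _ _ := ⟨(), mem_univ _⟩
  trans e _ _ x := (fderiv ℂ e.toHomeo x).det⁻¹
  holo e a b := by
    refine AnalyticOnNhd.inv ?_ fun x hx => det_fderiv_ne_zero e x hx.2.1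
    exact (analyticOnNhd_det_fderiv _ _ e.holo).mono fun x hx => hx.2.1
  ne_zero e a b x _ hx _ := inv_ne_zero (det_fderiv_ne_zero e x hx)
  germ e e' a b x _ _ _ _ h := by rw [h.fderiv_eq]
  cocycle e e' a b c x _ h1 _ h2 _ := by
    have h : fderiv ℂ (e.trans e').toHomeo x =
        (fderiv ℂ e'.toHomeo (e.toHomeo x)).comp (fderiv ℂ e.toHomeo x) :=
      fderiv_comp x (e'.holo _ h2).differentiableAt (e.holo x h1).differentiableAt
    rw [h, ← mul_inv]
    simp [ContinuousLinearMap.det, LinearMap.det_comp]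

end LineVBundle

/-- The positive integers `m` such that the anti-canonical V-bundle has an `m`-th root, i.e. there
is a holomorphic line V-bundle `L` with `L^m ≅ K⁻¹`. -/
def antiCanonicalRoots {n : ℕ} {X ι : Type} (φ : ι → (Fin n → ℂ) → X) : Set ℕ :=
  {m | 0 < m ∧ ∃ L : LineVBundle φ, (L.pow m).Iso (LineVBundle.canonical φ).dual}

/-- The index: the largest positive integer `m` such that the anti-canonical V-bundle has an
`m`-th root (meaningful if there is a largest one). -/
noncomputable def orbifoldIndex {n : ℕ} {X ι : Type} (φ : ι → (Fin n → ℂ) → X) : ℕ :=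
  sSup (antiCanonicalRoots φ)

/-! ### Fans in the lattice `N = ℤⁿ`, with dual lattice `M = ℤⁿ` under the dot product -/

/-- The inclusion `N = ℤⁿ ⊆ N_ℝ = ℝⁿ`. -/
def latR {n : ℕ} (v : Fin n → ℤ) : Fin n → ℝ := fun i => (v i : ℝ)

/-- Strongly convex rational polyhedral cones in `ℝⁿ`. -/
def IsRationalCone {n : ℕ} (σ : PointedCone ℝ (Fin n → ℝ)) : Prop :=
  (∃ S : Finset (Fin n → ℤ), σ = PointedCone.hull ℝ (latR '' (S : Set (Fin n → ℤ)))) ∧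
    ∀ x ∈ σ, -x ∈ σ → x = 0

/-- `τ` is a face of `σ`: `τ = σ ∩ m^⊥` for some `m` in the dual cone of `σ`. -/
def IsFaceOf {n : ℕ} (τ σ : PointedCone ℝ (Fin n → ℝ)) : Prop :=
  ∃ m : Fin n → ℝ, (∀ y ∈ σ, 0 ≤ m ⬝ᵥ y) ∧ ∀ y, y ∈ τ ↔ y ∈ σ ∧ m ⬝ᵥ y = 0

/-- The dimension of a cone: the dimension of its linear span. -/
noncomputable def coneDim {n : ℕ} (σ : PointedCone ℝ (Fin n → ℝ)) : ℕ :=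
  Module.finrank ℝ (Submodule.span ℝ (σ : Set (Fin n → ℝ)))

/-- A (finite) fan in `N = ℤⁿ`. -/
structure Fan (n : ℕ) where
  cones : Set (PointedCone ℝ (Fin n → ℝ))
  finite : cones.Finite
  rational : ∀ σ ∈ cones, IsRationalCone σ
  face_mem : ∀ σ ∈ cones, ∀ τ, IsFaceOf τ σ → τ ∈ cones
  inter_face : ∀ σ ∈ cones, ∀ τ ∈ cones, IsFaceOf (σ ⊓ τ) σ ∧ IsFaceOf (σ ⊓ τ) τ

/-- An augmented fan `Δ*`: a fan `Δ` together with a nonzero lattice point `n(ρ) = gen ρ` on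
every one-dimensional cone `ρ ∈ Δ(1)`. -/
structure AugmentedFan (n : ℕ) extends Fan n where
  gen : {ρ // ρ ∈ cones ∧ coneDim ρ = 1} → (Fin n → ℤ)
  gen_mem : ∀ ρ, latR (gen ρ) ∈ ρ.1
  gen_ne_zero : ∀ ρ, gen ρ ≠ 0

namespace AugmentedFan

variable {n : ℕ} (Δ : AugmentedFan n)

/-- The set `Δ(1)` of one-dimensional cones. -/
abbrev Ray : Type := {ρ // ρ ∈ Δ.cones ∧ coneDim ρ = 1}

/-- The fan is complete: its support is all of `N_ℝ`. -/
def IsComplete : Prop := ∀ x : Fin n → ℝ, ∃ σ ∈ Δ.cones, x ∈ σ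

/-- The fan is simplicial: every `n`-dimensional cone is generated by `n` linearly independent
lattice points. -/
def IsSimplicial : Prop :=
  ∀ σ ∈ Δ.cones, coneDim σ = n → ∃ p : Fin n → (Fin n → ℤ),
    LinearIndependent ℝ (fun i => latR (p i)) ∧
      σ = PointedCone.hull ℝ (range fun i => latR (p i))

/-! ### The toric variety and its orbifold charts -/

/-- The semigroup `S_σ = σ^∨ ∩ M`. -/
def dualMonoid (σ : PointedCone ℝ (Fin n → ℝ)) : AddSubmonoid (Fin n → ℤ) where
  carrier := {m | ∀ y ∈ σ, 0 ≤ latR m ⬝ᵥ y}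
  zero_mem' := by
    intro y _
    have : latR (0 : Fin n → ℤ) = 0 := by funext i; simp [latR]
    simp [this]
  add_mem' := by
    intro a b ha hb y hy
    have : latR (a + b) = latR a + latR b := by funext i; simp [latR]
    rw [this, add_dotProduct]
    exact add_nonneg (ha y hy) (hb y hy)

/-- The points of the affine toric variety `U_σ = Spec ℂ[S_σ]`: the semigroup homomorphisms from
`S_σ` to the multiplicative semigroup `ℂ`. -/
abbrev AffinePoint (σ : PointedCone ℝ (Fin n → ℝ)) : Type :=
  Multiplicative (dualMonoid σ) →* ℂ

theorem dualMonoid_anti {σ τ : PointedCone ℝ (Fin n → ℝ)} (h : τ ≤ σ) :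
    dualMonoid σ ≤ dualMonoid τ := fun _ hm y hy => hm y (h hy)

/-- The map `U_τ → U_σ` for `τ ⊆ σ`, dual to the inclusion `S_σ ⊆ S_τ`. -/
def affineIncl {σ τ : PointedCone ℝ (Fin n → ℝ)} (h : τ ≤ σ) (x : AffinePoint τ) :
    AffinePoint σ :=
  x.comp (AddMonoidHom.toMultiplicative (AddSubmonoid.inclusion (dualMonoid_anti h)))

/-- The gluing of the affine pieces: points of `U_σ` and of `U_τ` are identified when they come
from the same point of `U_{σ ∩ τ}`. -/
def Glue (p q : Σ σ : Δ.cones, AffinePoint σ.1) : Prop :=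
  ∃ z : AffinePoint (p.1.1 ⊓ q.1.1),
    affineIncl inf_le_left z = p.2 ∧ affineIncl inf_le_right z = q.2

/-- The (points of the) toric variety `X_Δ`, glued from the affine pieces `U_σ`, `σ ∈ Δ`. -/
def ToricVariety : Type := Quot Δ.Glue

/-- The index set of the orbifold charts: an `n`-dimensional cone `σ ∈ Δ(n)` together with an
ordering `ρ 0, …, ρ (n - 1)` of its rays, so that `σ` is the cone generated by the linearly
independent lattice points `p_i = n(ρ i)`. -/
structure Frame where
  ray : Fin n → Δ.Ray
  indep : LinearIndependent ℝ (fun i => latR (Δ.gen (ray i)))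
  cone_mem : PointedCone.hull ℝ (range fun i => latR (Δ.gen (ray i))) ∈ Δ.cones

namespace Frame

variable {Δ}

/-- The cone `σ` generated by the `p_i`. -/
def cone (F : Δ.Frame) : PointedCone ℝ (Fin n → ℝ) :=
  PointedCone.hull ℝ (range fun i => latR (Δ.gen (F.ray i)))

theorem pairing_nonneg (F : Δ.Frame) (m : dualMonoid F.cone) (i : Fin n) :
    0 ≤ (m : Fin n → ℤ) ⬝ᵥ Δ.gen (F.ray i) := by
  have h := m.2 (latR (Δ.gen (F.ray i))) (Submodule.subset_span (mem_range_self i))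
  have h2 : latR (m : Fin n → ℤ) ⬝ᵥ latR (Δ.gen (F.ray i)) =
      (((m : Fin n → ℤ) ⬝ᵥ Δ.gen (F.ray i) : ℤ) : ℝ) := by
    simp [dotProduct, latR]
  rw [h2] at h
  exact_mod_cast h

/-- Let `N' = ℤ{p_1, …, p_n} ⊆ N`, with dual lattice `M' ⊇ M`, and let `σ'` be the cone `σ`
considered in `N'`.  Then `U_{σ'} = ℂⁿ`, with the coordinates given by the basis of `M'` dual to
`p_1, …, p_n`, and the quotient map `U_{σ'} → U_{σ'} / (N / N') = U_σ` sends `z` to the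
homomorphism `m ↦ ∏ i, z_i ^ ⟨m, p_i⟩`. -/
def affineMap (F : Δ.Frame) (z : Fin n → ℂ) : AffinePoint F.cone where
  toFun m := ∏ i, z i ^ ((m.toAdd : Fin n → ℤ) ⬝ᵥ Δ.gen (F.ray i)).toNat
  map_one' := by simp
  map_mul' a b := by
    rw [← Finset.prod_mul_distrib]
    refine Finset.prod_congr rfl fun i _ => ?_
    rw [← pow_add, ← Int.toNat_add (F.pairing_nonneg _ i) (F.pairing_nonneg _ i)]
    simp [add_dotProduct]

end Frame

/-- The uniformizing charts `ℂⁿ = U_{σ'} → U_σ ⊆ X_Δ`, which define the toric orbifold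
`X_{Δ*}`. -/
def chart (F : Δ.Frame) (z : Fin n → ℂ) : Δ.ToricVariety :=
  Quot.mk _ ⟨⟨F.cone, F.cone_mem⟩, F.affineMap z⟩

/-! ### Support functions, the Fano condition, and symmetries -/

/-- `h ∈ SF(Δ*)`: on every cone `σ` of the fan, `h` is a rational linear function `l_σ` that is
integral on the lattice spanned by the points `n(ρ)`, `ρ ⊆ σ`. -/
def IsSupportFunction (h : (Fin n → ℝ) → ℝ) : Prop :=
  ∀ σ ∈ Δ.cones, ∃ l : Fin n → ℚ,
    (∀ s ∈ σ, h s = (fun i => (l i : ℝ)) ⬝ᵥ s) ∧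
    ∀ ρ : Δ.Ray, ρ.1 ≤ σ → ∃ z : ℤ, (fun i => (l i : ℝ)) ⬝ᵥ latR (Δ.gen ρ) = z

/-- Strict upper convexity of a support function `h`: it is superadditive on `N_ℚ`, and it is
given by different linear functions on different `n`-dimensional cones. -/
def IsStrictlyUpperConvex (h : (Fin n → ℝ) → ℝ) : Prop :=
  (∀ x y : Fin n → ℚ,
    h (fun i => (x i : ℝ)) + h (fun i => (y i : ℝ)) ≤ h (fun i => ((x i + y i : ℚ) : ℝ))) ∧
  ∀ σ ∈ Δ.cones, ∀ τ ∈ Δ.cones, coneDim σ = n → coneDim τ = n → σ ≠ τ →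
    ∀ l l' : Fin n → ℝ, (∀ s ∈ σ, h s = l ⬝ᵥ s) → (∀ s ∈ τ, h s = l' ⬝ᵥ s) → l ≠ l'

/-- The toric orbifold is Fano: `-k` is strictly upper convex, where `k ∈ SF(Δ*)` is the support
function of the canonical divisor, with `k (n(ρ)) = 1` for all rays `ρ`. -/
def IsFano : Prop :=
  ∃ k : (Fin n → ℝ) → ℝ, Δ.IsSupportFunction k ∧ (∀ ρ : Δ.Ray, k (latR (Δ.gen ρ)) = 1) ∧
    Δ.IsStrictlyUpperConvex (-k)

end AugmentedFan

/-- The action of `γ ∈ GL(n, ℤ)` on `N_ℝ = ℝⁿ`. -/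
def glR {n : ℕ} (γ : GL (Fin n) ℤ) : (Fin n → ℝ) →ₗ[ℝ] (Fin n → ℝ) :=
  ((γ : Matrix (Fin n) (Fin n) ℤ).map (Int.cast : ℤ → ℝ)).mulVecLin

theorem glR_one {n : ℕ} : glR (1 : GL (Fin n) ℤ) = LinearMap.id := by
  simp [glR, Matrix.map_one]

theorem glR_mul {n : ℕ} (γ δ : GL (Fin n) ℤ) : glR (γ * δ) = (glR γ).comp (glR δ) := by
  rw [glR, glR, glR, ← Matrix.mulVecLin_mul]
  congr 1
  exact Matrix.map_mul (f := Int.castRingHom ℝ)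

theorem map_glR_inv {n : ℕ} (γ : GL (Fin n) ℤ) (σ : PointedCone ℝ (Fin n → ℝ)) :
    (σ.map (glR γ)).map (glR γ⁻¹) = σ := by
  rw [PointedCone.map_map, ← glR_mul, inv_mul_cancel, glR_one, PointedCone.map_id]

theorem map_glR_inv' {n : ℕ} (γ : GL (Fin n) ℤ) (σ : PointedCone ℝ (Fin n → ℝ)) :
    (σ.map (glR γ⁻¹)).map (glR γ) = σ := by
  simpa using map_glR_inv γ⁻¹ σ

theorem coneDim_map_glR {n : ℕ} (γ : GL (Fin n) ℤ) (σ : PointedCone ℝ (Fin n → ℝ)) :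
    coneDim (σ.map (glR γ)) = coneDim σ := by
  have hinj : Function.Injective (glR γ) := by
    have h : Function.LeftInverse (glR γ⁻¹) (glR γ) := fun x => by
      have := LinearMap.congr_fun (glR_mul γ⁻¹ γ) x
      rw [inv_mul_cancel, glR_one] at this
      exact this.symm
    exact h.injective
  have h : Submodule.span ℝ ((σ.map (glR γ) : PointedCone ℝ (Fin n → ℝ)) : Set (Fin n → ℝ)) =
      (Submodule.span ℝ (σ : Set (Fin n → ℝ))).map (glR γ) := by
    rw [Submodule.map_span]
    rfl
  rw [coneDim, coneDim, h]
  exact (LinearEquiv.finrank_eq (Submodule.equivMapOfInjective (glR γ) hinj _)).symm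

/-- The group `W₀(X)` of the symmetries `γ ∈ GL(n, ℤ)` of the augmented fan: `γ` permutes the
cones of the fan and carries `n(ρ)` to `n(γ ρ)` for every ray `ρ`. -/
def AugmentedFan.symmetryGroup {n : ℕ} (Δ : AugmentedFan n) : Subgroup (GL (Fin n) ℤ) where
  carrier := {γ | (∀ σ, σ.map (glR γ) ∈ Δ.cones ↔ σ ∈ Δ.cones) ∧
    ∀ ρ ρ' : Δ.Ray, ρ'.1 = ρ.1.map (glR γ) →
      Δ.gen ρ' = (γ : Matrix (Fin n) (Fin n) ℤ) *ᵥ Δ.gen ρ}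
  one_mem' := by
    refine ⟨fun σ => by rw [glR_one, PointedCone.map_id], fun ρ ρ' h => ?_⟩
    rw [glR_one, PointedCone.map_id] at h
    rw [Subtype.ext h]
    simp
  mul_mem' := by
    rintro γ δ ⟨h1, h2⟩ ⟨h3, h4⟩
    refine ⟨fun σ => ?_, fun ρ ρ' h => ?_⟩
    · rw [glR_mul, ← PointedCone.map_map, h1, h3]
    · rw [glR_mul, ← PointedCone.map_map] at h
      rw [h2 ⟨ρ.1.map (glR δ), (h3 _).2 ρ.2.1, (coneDim_map_glR δ _).trans ρ.2.2⟩ ρ' h,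
        h4 ρ _ rfl]
      simp [Matrix.mulVec_mulVec]
  inv_mem' := by
    rintro γ ⟨h1, h2⟩
    refine ⟨fun σ => ?_, fun ρ ρ' h => ?_⟩
    · rw [← h1, map_glR_inv' γ]
    · have h5 : ρ.1 = ρ'.1.map (glR γ) := by rw [h, map_glR_inv' γ]
      rw [h2 ρ' ρ h5, Matrix.mulVec_mulVec, ← Units.val_mul, inv_mul_cancel]
      simp

/-! ### Roots of a trivialization of a power of a line bundle -/

/-! The bound on the index comes from one rational curve. A full-dimensional cone σ with generators
`p_i` gives a chart, the symmetry gives a second chart for −σ with generators `-p_i`, and the two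
overlap on the torus through z ↦ z⁻¹ (`AugmentedFan.Frame.negChange`). The lines (1, …, t, …, 1) in
the two charts are glued by t ↦ t⁻¹ and form a projective line, on which K⁻¹ has transition function
(−1)ⁿ t⁻², hence degree 2. If L^m ≅ K⁻¹, the degree of L on this line multiplied by m is 2, so m
divides 2 (`LineVBundle.dvd_two_of_iso`). Since K⁻¹ is a first root of itself, the set of possible m
is nonempty and consists of divisors of 2.

The degree is handled topologically. An isomorphism L^m ≅ K⁻¹ together with the standard
trivialization of K⁻¹ on a chart trivializes L^m there. Over a square in the t-plane that
trivialization has a continuous m-th root, which trivializes L: roots exist locally, and they glue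
along connected intersections after correction by a root of unity (`HasRootFrame.union`,
`hasRootFrame_square`). The square contains the unit circle, so comparing the roots from the two
charts there gives a continuous h with h^m = c t⁻², and a winding number argument
(`dvd_two_of_pow_eq`) forces m ∣ 2. -/

/-- A continuous frame over `S` of the line bundle with transition functions `g`, whose `m`-th
power is the frame `u` of the `m`-th power of the bundle. -/
def HasRootFrame {B κ : Type} [TopologicalSpace B] (dom : κ → Set B) (g : κ → κ → B → ℂ)
    (u : κ → B → ℂ) (m : ℕ) (S : Set B) : Prop :=
  ∃ f : κ → B → ℂ, (∀ a, ContinuousOn (f a) (S ∩ dom a)) ∧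
    (∀ a, ∀ x ∈ S, x ∈ dom a → f a x ^ m = u a x) ∧
    ∀ a b, ∀ x ∈ S, x ∈ dom a → x ∈ dom b → f b x * g a b x = f a x

/-- A continuous function on a preconnected set all of whose values are `m`-th roots of unity is
constant. -/
theorem IsPreconnected.eq_of_pow_eq_one {B : Type} [TopologicalSpace B] {S : Set B}
    (hS : IsPreconnected S) {m : ℕ} (hm : 0 < m) {h : B → ℂ} (hc : ContinuousOn h S)
    (h1 : ∀ x ∈ S, h x ^ m = 1) {x y : B} (hx : x ∈ S) (hy : y ∈ S) : h x = h y := by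
  have hfin : {z : ℂ | z ^ m = 1}.Finite := by
    have h2 : (Polynomial.X ^ m - Polynomial.C (1 : ℂ)) ≠ 0 :=
      Polynomial.X_pow_sub_C_ne_zero hm 1
    refine (Polynomial.finite_setOfPred_isRoot h2).subset fun z hz => ?_
    have hz' : z ^ m = 1 := hz
    simp [Polynomial.IsRoot, hz']
  exact hS.constant_of_mapsTo (T := {z : ℂ | z ^ m = 1}) hfin.isDiscrete hc h1 hx hy

section RootFrame

variable {B κ : Type} [TopologicalSpace B] {dom : κ → Set B} {g : κ → κ → B → ℂ}
  {u : κ → B → ℂ} {m : ℕ}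

theorem HasRootFrame.mono {S T : Set B} (h : HasRootFrame dom g u m T) (hST : S ⊆ T) :
    HasRootFrame dom g u m S := by
  obtain ⟨f, h1, h2, h3⟩ := h
  exact ⟨f, fun a => (h1 a).mono (inter_subset_inter_left _ hST),
    fun a x hx => h2 a x (hST hx), fun a b x hx => h3 a b x (hST hx)⟩

/-- Two root frames over closed sets with connected intersection glue, after multiplying one of
them by a root of unity. -/
theorem HasRootFrame.union (hm : 0 < m) (hdom : ∀ a, IsOpen (dom a)) (hcov : ∀ x, ∃ a, x ∈ dom a)
    (hu0 : ∀ a, ∀ x ∈ dom a, u a x ≠ 0) {S T : Set B} (hSc : IsClosed S) (hTc : IsClosed T)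
    (hconn : IsConnected (S ∩ T)) (hS : HasRootFrame dom g u m S)
    (hT : HasRootFrame dom g u m T) : HasRootFrame dom g u m (S ∪ T) := by
  classical
  obtain ⟨f, f1, f2, f3⟩ := hS
  obtain ⟨k, k1, k2, k3⟩ := hT
  have fne : ∀ a, ∀ x ∈ S, x ∈ dom a → f a x ≠ 0 := fun a x hx ha h0 => by
    have := f2 a x hx ha
    rw [h0, zero_pow hm.ne'] at this
    exact hu0 a x ha this.symm
  have kne : ∀ a, ∀ x ∈ T, x ∈ dom a → k a x ≠ 0 := fun a x hx ha h0 => by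
    have := k2 a x hx ha
    rw [h0, zero_pow hm.ne'] at this
    exact hu0 a x ha this.symm
  choose A hA using hcov
  -- The choice `A` need not be continuous in x. Both frames transform by the same `g`, so their
  -- ratio does not depend on the index, and continuity can be checked near each point with a fixed
  -- index.
  have hratio : ∀ x ∈ S ∩ T, ∀ a, x ∈ dom a → f (A x) x / k (A x) x = f a x / k a x := by
    intro x hx a ha
    have e1 := f3 (A x) a x hx.1 (hA x) ha
    have e2 := k3 (A x) a x hx.2 (hA x) ha
    have hg : g (A x) a x ≠ 0 := fun h0 => by
      rw [h0, mul_zero] at e1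
      exact fne _ x hx.1 (hA x) e1.symm
    rw [← e1, ← e2, mul_div_mul_right _ _ hg]
  have hc : ContinuousOn (fun x => f (A x) x / k (A x) x) (S ∩ T) := by
    intro x hx
    have h1 : ContinuousWithinAt (fun y => f (A x) y / k (A x) y) ((S ∩ T) ∩ dom (A x)) x :=
      ((f1 (A x) x ⟨hx.1, hA x⟩).mono fun y hy => ⟨hy.1.1, hy.2⟩).div
        ((k1 (A x) x ⟨hx.2, hA x⟩).mono fun y hy => ⟨hy.1.2, hy.2⟩) (kne _ x hx.2 (hA x))
    have h2 : ContinuousWithinAt (fun y => f (A y) y / k (A y) y) ((S ∩ T) ∩ dom (A x)) x :=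
      h1.congr (fun y hy => hratio y hy.1 _ hy.2) rfl
    exact (continuousWithinAt_inter ((hdom (A x)).mem_nhds (hA x))).1 h2
  obtain ⟨x₀, hx₀⟩ := hconn.nonempty
  set ζ := f (A x₀) x₀ / k (A x₀) x₀ with hζ
  have hpow : ∀ x ∈ S ∩ T, (f (A x) x / k (A x) x) ^ m = 1 := fun x hx => by
    rw [div_pow, f2 _ x hx.1 (hA x), k2 _ x hx.2 (hA x), div_self (hu0 _ x (hA x))]
  have hfk : ∀ a, ∀ x ∈ S, x ∈ T → x ∈ dom a → f a x = ζ * k a x := fun a x hx hx' ha => by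
    have h1 := hconn.isPreconnected.eq_of_pow_eq_one hm hc hpow hx₀ ⟨hx, hx'⟩
    rw [hζ, h1, hratio x ⟨hx, hx'⟩ a ha, div_mul_cancel₀ _ (kne a x hx' ha)]
  have hζm : ζ ^ m = 1 := hpow x₀ hx₀
  let F : κ → B → ℂ := fun a x => if x ∈ S then f a x else ζ * k a x
  have FS : ∀ a, ∀ x ∈ S, F a x = f a x := fun a x hx => if_pos hx
  have FT : ∀ a, ∀ x ∈ T, x ∈ dom a → F a x = ζ * k a x := fun a x hx ha => by
    by_cases h : x ∈ S
    · rw [FS a x h, hfk a x h hx ha]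
    · exact if_neg h
  refine ⟨F, fun a => ?_, ?_, ?_⟩
  · have c1 : ContinuousOn (F a) (S ∩ dom a) := (f1 a).congr fun x hx => FS a x hx.1
    have c2 : ContinuousOn (F a) (T ∩ dom a) :=
      (continuousOn_const.mul (k1 a)).congr fun x hx => FT a x hx.1 hx.2
    -- Off the closed set `R` the point is not in the closure, so continuity within `R` is vacuous;
    -- this is where closedness of both pieces enters.
    have aux : ∀ {R : Set B}, IsClosed R → ContinuousOn (F a) (R ∩ dom a) → ∀ x,
        x ∈ dom a → ContinuousWithinAt (F a) (R ∩ dom a) x := by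
      intro R hR hcR x hx
      by_cases h : x ∈ R
      · exact hcR x ⟨h, hx⟩
      · refine continuousWithinAt_of_notMem_closure fun h' => h ?_
        exact hR.closure_subset (closure_mono inter_subset_left h')
    intro x hx
    rw [union_inter_distrib_right]
    exact (aux hSc c1 x hx.2).union (aux hTc c2 x hx.2)
  · rintro a x (hx | hx) ha
    · rw [FS a x hx, f2 a x hx ha]
    · rw [FT a x hx ha, mul_pow, hζm, one_mul, k2 a x hx ha]
  · rintro a b x (hx | hx) ha hb
    · rw [FS a x hx, FS b x hx, f3 a b x hx ha hb]
    · rw [FT a x hx ha, FT b x hx hb, mul_assoc, k3 a b x hx ha hb]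

/-! ### Existence of root frames: locally, then on a square -/

/-- A nowhere vanishing function has continuous `m`-th roots locally. -/
theorem exists_continuousOn_root {v : B → ℂ} (hm : 0 < m) {x : B} (hv : ContinuousAt v x)
    {D : Set B} (hD : D ∈ 𝓝 x) (hvc : ContinuousOn v D) (hx : v x ≠ 0) :
    ∃ U ∈ 𝓝 x, U ⊆ D ∧ ∃ f : B → ℂ, ContinuousOn f U ∧ ∀ y ∈ U, f y ^ m = v y := by
  obtain ⟨w, hw⟩ := IsAlgClosed.exists_pow_nat_eq (v x) hm
  -- Near x the quotient v / v(x) is close to 1, hence in the slit plane, where the principal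
  -- logarithm supplies an m-th root; `w` restores the value at x.
  have hq : ContinuousAt (fun y => v y / v x) x := hv.div_const _
  have h1 : (fun y => v y / v x) ⁻¹' Complex.slitPlane ∈ 𝓝 x := by
    refine hq.preimage_mem_nhds (Complex.isOpen_slitPlane.mem_nhds ?_)
    simp [div_self hx]
  refine ⟨D ∩ (fun y => v y / v x) ⁻¹' Complex.slitPlane, inter_mem hD h1, inter_subset_left,
    fun y => w * Complex.exp (Complex.log (v y / v x) / m), ?_, ?_⟩
  · refine continuousOn_const.mul (ContinuousOn.cexp (ContinuousOn.div_const ?_ _))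
    exact ContinuousOn.clog ((hvc.mono inter_subset_left).div_const _) fun y hy => hy.2
  · intro y hy
    have hm' : (m : ℂ) ≠ 0 := by exact_mod_cast hm.ne'
    rw [mul_pow, hw, ← Complex.exp_nat_mul, mul_div_cancel₀ _ hm',
      Complex.exp_log (Complex.slitPlane_ne_zero hy.2), mul_div_cancel₀ _ hx]

/-- Fix one trivialization `c` near x and take a local root of `u c`; the other components are then
forced to be its multiples by `g a c`. -/
theorem exists_hasRootFrame_nhds (hm : 0 < m) (hdom : ∀ a, IsOpen (dom a))
    (hcov : ∀ x, ∃ a, x ∈ dom a) (hg : ∀ a b, ContinuousOn (g a b) (dom a ∩ dom b))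
    (hco : ∀ a b c, ∀ x ∈ dom a, x ∈ dom b → x ∈ dom c → g a c x = g b c x * g a b x)
    (hu : ∀ a, ContinuousOn (u a) (dom a)) (hu0 : ∀ a, ∀ x ∈ dom a, u a x ≠ 0)
    (hug : ∀ a b, ∀ x ∈ dom a, x ∈ dom b → u b x * g a b x ^ m = u a x) (x : B) :
    ∃ U, IsOpen U ∧ x ∈ U ∧ HasRootFrame dom g u m U := by
  obtain ⟨c, hc⟩ := hcov x
  have hD := (hdom c).mem_nhds hc
  obtain ⟨U, hU, hUD, f, hf, hfm⟩ := exists_continuousOn_root hm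
    ((hu c).continuousAt hD) hD (hu c) (hu0 c x hc)
  obtain ⟨V, hVU, hV, hxV⟩ := mem_nhds_iff.1 hU
  refine ⟨V, hV, hxV, fun a y => f y * g a c y, fun a => ?_, ?_, ?_⟩
  · exact (hf.mono fun y hy => hVU hy.1).mul
      ((hg a c).mono fun y hy => ⟨hy.2, hUD (hVU hy.1)⟩)
  · intro a y hy ha
    simp only
    rw [mul_pow, hfm y (hVU hy), hug a c y ha (hUD (hVU hy))]
  · intro a b y hy ha hb
    simp only
    rw [mul_assoc, hco a b c y ha hb (hUD (hVU hy))]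

end RootFrame

/-- Over a square there is a global root frame. -/
theorem hasRootFrame_square {κ : Type} {dom : κ → Set (ℝ × ℝ)} {g : κ → κ → ℝ × ℝ → ℂ}
    {u : κ → ℝ × ℝ → ℂ} {m : ℕ} (hm : 0 < m) (hdom : ∀ a, IsOpen (dom a))
    (hcov : ∀ x, ∃ a, x ∈ dom a) (hg : ∀ a b, ContinuousOn (g a b) (dom a ∩ dom b))
    (hco : ∀ a b c, ∀ x ∈ dom a, x ∈ dom b → x ∈ dom c → g a c x = g b c x * g a b x)
    (hu : ∀ a, ContinuousOn (u a) (dom a)) (hu0 : ∀ a, ∀ x ∈ dom a, u a x ≠ 0)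
    (hug : ∀ a b, ∀ x ∈ dom a, x ∈ dom b → u b x * g a b x ^ m = u a x) :
    HasRootFrame dom g u m (Icc (-1) 1 ×ˢ Icc (-1) 1) := by
  choose U hUo hxU hU using exists_hasRootFrame_nhds hm hdom hcov hg hco hu hu0 hug
  have hK : IsCompact (Icc (-2 : ℝ) 2 ×ˢ Icc (-2 : ℝ) 2) := isCompact_Icc.prod isCompact_Icc
  obtain ⟨δ, hδ, hleb⟩ := lebesgue_number_lemma_of_metric hK hUo
    (fun x _ => mem_iUnion.2 ⟨x, hxU x⟩)
  -- A mesh 2 / N below the Lebesgue number δ puts each closed cell in the max-metric ball of radius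
  -- δ about its lower left corner.
  obtain ⟨N, hN⟩ := exists_nat_gt (2 / δ)
  have hN0 : (0 : ℝ) < N := lt_trans (by positivity) hN
  have hstep : 2 / (N : ℝ) < δ := by
    rw [div_lt_iff₀ hN0]
    rw [div_lt_iff₀ hδ] at hN
    linarith
  set d : ℝ := 2 / N with hd
  have hd0 : 0 < d := by positivity
  have hNd : (N : ℝ) * d = 2 := by rw [hd]; field_simp
  let p : ℕ → ℝ := fun k => -1 + k * d
  have hp : ∀ k, p (k + 1) = p k + d := fun k => by simp only [p]; push_cast; ring
  have hp0 : p 0 = -1 := by simp [p]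
  have hpN : p N = 1 := by simp only [p]; linarith
  have hple : ∀ k, -1 ≤ p k := fun k => by
    have : 0 ≤ (k : ℝ) * d := by positivity
    simp only [p]; linarith
  have hpN' : ∀ k ≤ N, p k ≤ 1 := fun k hk => by
    have : (k : ℝ) * d ≤ N * d := by gcongr
    simp only [p]; linarith
  -- Indices run to N inclusive, so the last cells reach beyond 1; the excess is cut off by
  -- `HasRootFrame.mono`.
  have hsmall : ∀ i ≤ N, ∀ j ≤ N,
      HasRootFrame dom g u m (Icc (p i) (p (i + 1)) ×ˢ Icc (p j) (p (j + 1))) := by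
    intro i hi j hj
    obtain ⟨x, hx⟩ := hleb (p i, p j) ⟨⟨by linarith [hple i], by linarith [hpN' i hi]⟩,
      ⟨by linarith [hple j], by linarith [hpN' j hj]⟩⟩
    refine (hU x).mono (subset_trans ?_ hx)
    rintro ⟨s, t⟩ ⟨⟨h1, h2⟩, ⟨h3, h4⟩⟩
    rw [hp] at h2 h4
    simp only at h1 h2 h3 h4
    rw [Metric.mem_ball, Prod.dist_eq, Real.dist_eq, Real.dist_eq, max_lt_iff, abs_lt, abs_lt]
    refine ⟨⟨?_, ?_⟩, ⟨?_, ?_⟩⟩ <;> simp only <;> linarith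
  have hrow : ∀ j ≤ N, ∀ i ≤ N,
      HasRootFrame dom g u m (Icc (-1) (p (i + 1)) ×ˢ Icc (p j) (p (j + 1))) := by
    intro j hj i
    induction i with
    | zero => intro h; have := hsmall 0 h j hj; rwa [hp0] at this
    | succ i ih =>
      intro h
      have h1 := HasRootFrame.union hm hdom hcov hu0 (isClosed_Icc.prod isClosed_Icc)
        (isClosed_Icc.prod isClosed_Icc) ?_ (ih (by omega)) (hsmall (i + 1) h j hj)
      · rwa [← union_prod, Icc_union_Icc_eq_Icc (hple _) (by rw [hp (i + 1)]; linarith)] at h1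
      -- Neighbouring cells of a row meet in a vertical edge, which is connected; below,
      -- neighbouring rows meet in a horizontal segment.
      · rw [prod_inter_prod, inter_self, Icc_inter_Icc_eq_singleton (hple _)
          (by rw [hp (i + 1)]; linarith)]
        exact isConnected_singleton.prod (isConnected_Icc (by rw [hp j]; linarith))
  have hall : ∀ j ≤ N,
      HasRootFrame dom g u m (Icc (-1) 1 ×ˢ Icc (-1) (p (j + 1))) := by
    have hrow' : ∀ j ≤ N, HasRootFrame dom g u m (Icc (-1) 1 ×ˢ Icc (p j) (p (j + 1))) :=
      fun j hj => (hrow j hj N le_rfl).mono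
        (prod_mono (Icc_subset_Icc_right (by rw [hp, hpN]; linarith)) subset_rfl)
    intro j
    induction j with
    | zero => intro h; have := hrow' 0 h; rwa [hp0] at this
    | succ j ih =>
      intro h
      have h1 := HasRootFrame.union hm hdom hcov hu0 (isClosed_Icc.prod isClosed_Icc)
        (isClosed_Icc.prod isClosed_Icc) ?_ (ih (by omega)) (hrow' (j + 1) h)
      · rwa [← prod_union, Icc_union_Icc_eq_Icc (hple _) (by rw [hp (j + 1)]; linarith)] at h1
      · rw [prod_inter_prod, inter_self, Icc_inter_Icc_eq_singleton (hple _)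
          (by rw [hp (j + 1)]; linarith)]
        exact (isConnected_Icc (by norm_num)).prod isConnected_singleton
  exact (hall N le_rfl).mono
    (prod_mono subset_rfl (Icc_subset_Icc_right (by rw [hp, hpN]; linarith)))

/-! ### The winding number obstruction -/

/-- If `c t⁻²` has a continuous `m`-th root on the unit circle, then `m` divides `2`. -/
theorem dvd_two_of_pow_eq {m : ℕ} (hm : 0 < m) {c : ℂ} (hc : c ≠ 0) {h : ℂ → ℂ}
    (hcont : ContinuousOn h {t | ‖t‖ = 1}) (hpow : ∀ t, ‖t‖ = 1 → h t ^ m = c * (t ^ 2)⁻¹) :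
    m ∣ 2 := by
  have hm' : (m : ℂ) ≠ 0 := by exact_mod_cast hm.ne'
  have h1 : h 1 ≠ 0 := fun h0 => by
    have := hpow 1 (by simp)
    rw [h0, zero_pow hm.ne'] at this
    simp [hc.symm] at this
  have hnorm : ∀ θ : ℝ, ‖Complex.exp (θ * Complex.I)‖ = 1 := Complex.norm_exp_ofReal_mul_I
  -- The second factor is an m-th root of t² along t = exp(iθ), so q^m = 1 and q is constant. Its
  -- values at 0 and 2π are 1 and exp(4πi/m), whence 2/m is an integer.
  let q : ℝ → ℂ := fun θ =>
    h (Complex.exp (θ * Complex.I)) / h 1 * Complex.exp (2 * (θ * Complex.I) / m)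
  have hq : Continuous q := by
    refine Continuous.mul (Continuous.div_const ?_ _) (by fun_prop)
    exact hcont.comp_continuous (by fun_prop) hnorm
  have hqm : ∀ θ, q θ ^ m = 1 := fun θ => by
    have h2 := hpow 1 (by simp)
    simp only [q]
    rw [mul_pow, div_pow, hpow _ (hnorm θ), h2, ← Complex.exp_nat_mul _ m, mul_div_cancel₀ _ hm',
      ← Complex.exp_nat_mul]
    push_cast
    field_simp
  have := isPreconnected_univ.eq_of_pow_eq_one hm hq.continuousOn (fun θ _ => hqm θ)
    (mem_univ (2 * Real.pi)) (mem_univ 0)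
  simp only [q] at this
  push_cast at this
  rw [Complex.exp_two_pi_mul_I] at this
  simp only [div_self h1, zero_mul, Complex.exp_zero, mul_zero, zero_div, one_mul] at this
  obtain ⟨k, hk⟩ := Complex.exp_eq_one_iff.1 this
  have hpi : (2 * Real.pi * Complex.I : ℂ) ≠ 0 := Complex.two_pi_I_ne_zero
  rw [div_eq_iff hm'] at hk
  have h3 : (2 : ℂ) = k * m := by
    apply mul_right_cancel₀ hpi
    linear_combination hk
  have h4 : (2 : ℤ) = m * k := by
    rw [mul_comm]
    exact_mod_cast h3
  exact_mod_cast Dvd.intro k h4.symm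

/-! ### Changes of charts, and the degree of a line V-bundle on an invariant curve -/

/-- The identity change of charts. -/
noncomputable def ChartChange.refl {n : ℕ} {X ι : Type} (φ : ι → (Fin n → ℂ) → X) (i : ι) :
    ChartChange φ i i where
  toHomeo := OpenPartialHomeomorph.refl _
  holo := analyticOnNhd_id
  holo_symm := analyticOnNhd_id
  proj_eq _ _ := rfl

/-- The affine line `t ↦ (1, …, 1, t, 1, …, 1)`. -/
def coordLine {n : ℕ} (i₀ : Fin n) (t : ℂ) : Fin n → ℂ := fun i => if i = i₀ then t else 1

theorem continuous_coordLine {n : ℕ} (i₀ : Fin n) : Continuous (coordLine i₀) := by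
  refine continuous_pi fun i => ?_
  unfold coordLine
  split_ifs <;> fun_prop

theorem norm_one_subset_square {t : ℂ} (ht : ‖t‖ = 1) :
    (t.re, t.im) ∈ (Icc (-1 : ℝ) 1 ×ˢ Icc (-1 : ℝ) 1) := by
  have h1 := abs_le.1 (ht ▸ Complex.abs_re_le_norm t)
  have h2 := abs_le.1 (ht ▸ Complex.abs_im_le_norm t)
  exact ⟨h1, h2⟩

namespace LineVBundle

variable {n : ℕ} {X ι : Type} {φ : ι → (Fin n → ℂ) → X} (L : LineVBundle φ)

/-- The lift of the identity plays the role of the ordinary transition functions of L within one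
chart. This and the next lemma hold because composing `e` with the identity does not change its
germ. -/
theorem trans_refl_mul {i j : ι} (e : ChartChange φ i j) (a a' : L.κ i) (b : L.κ j)
    {x : Fin n → ℂ} (ha : x ∈ L.dom i a) (ha' : x ∈ L.dom i a') (hx : x ∈ e.toHomeo.source)
    (hb : e.toHomeo x ∈ L.dom j b) :
    L.trans e a b x = L.trans e a' b x * L.trans (ChartChange.refl φ i) a a' x := by
  refine Eq.trans ?_ (L.cocycle (ChartChange.refl φ i) e a a' b x ha (mem_univ x) ha' hx hb)
  refine L.germ _ _ a b x ha hx ⟨mem_univ x, hx⟩ hb ?_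
  exact Eventually.of_forall fun y => rfl

theorem mul_trans_refl {i j : ι} (e : ChartChange φ i j) (a : L.κ i) (b b' : L.κ j)
    {x : Fin n → ℂ} (ha : x ∈ L.dom i a) (hx : x ∈ e.toHomeo.source)
    (hb : e.toHomeo x ∈ L.dom j b) (hb' : e.toHomeo x ∈ L.dom j b') :
    L.trans e a b' x =
      L.trans (ChartChange.refl φ j) b b' (e.toHomeo x) * L.trans e a b x := by
  refine Eq.trans ?_ (L.cocycle e (ChartChange.refl φ j) a b b' x ha hx hb (mem_univ _) hb')
  refine L.germ _ _ a b' x ha hx ⟨hx, mem_univ _⟩ hb' ?_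
  exact Eventually.of_forall fun y => rfl

/-- If `L^m` is isomorphic to `K⁻¹`, then on the unit circle of a coordinate line of a chart, the
frame `∂₁ ∧ ⋯ ∧ ∂ₙ` of `K⁻¹` is the `m`-th power of a continuous frame of `L`. -/
theorem hasRootFrame_circle (i₀ : Fin n) {m : ℕ} (hm : 0 < m) (i : ι) {u : L.κ i → (Fin n → ℂ) → ℂ}
    (hu : ∀ a, ContinuousOn (u a) (L.dom i a)) (hu0 : ∀ a, ∀ x ∈ L.dom i a, u a x ≠ 0)
    (hug : ∀ a b, ∀ x ∈ L.dom i a, x ∈ L.dom i b →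
      u b x * L.trans (ChartChange.refl φ i) a b x ^ m = u a x) :
    HasRootFrame (fun a => coordLine i₀ ⁻¹' L.dom i a)
      (fun a b t => L.trans (ChartChange.refl φ i) a b (coordLine i₀ t))
      (fun a t => u a (coordLine i₀ t)) m {t | ‖t‖ = 1} := by
  -- The root is taken over the whole square and only then restricted: on the circle alone,
  -- monodromy could obstruct it.
  let γ : ℝ × ℝ → Fin n → ℂ := fun p => coordLine i₀ (p.1 + p.2 * Complex.I)
  have hγ : Continuous γ := (continuous_coordLine i₀).comp (by fun_prop)
  obtain ⟨f, h1, h2, h3⟩ := hasRootFrame_square (dom := fun a => γ ⁻¹' L.dom i a)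
    (g := fun a b p => L.trans (ChartChange.refl φ i) a b (γ p)) (u := fun a p => u a (γ p)) hm
    (fun a => (L.isOpen_dom i a).preimage hγ) (fun x => L.cover i (γ x))
    (fun a b => (L.holo (ChartChange.refl φ i) a b).continuousOn.comp hγ.continuousOn
      fun x hx => ⟨hx.1, mem_univ _, hx.2⟩)
    (fun a b c x ha hb hc => L.trans_refl_mul _ a b c ha hb (mem_univ _) hc)
    (fun a => (hu a).comp hγ.continuousOn fun x hx => hx)
    (fun a x hx => hu0 a _ hx) (fun a b x ha hb => hug a b _ ha hb)
  have hre : ∀ t : ℂ, γ (t.re, t.im) = coordLine i₀ t := fun t => by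
    simp only [γ, Complex.re_add_im]
  refine ⟨fun a t => f a (t.re, t.im), fun a => ?_, fun a t ht ha => ?_,
    fun a b t ht ha hb => ?_⟩
  · refine (h1 a).comp (by fun_prop) fun t ht => ⟨norm_one_subset_square ht.1, ?_⟩
    simpa only [mem_preimage, hre] using ht.2
  · have := h2 a (t.re, t.im) (norm_one_subset_square ht) (by simpa only [mem_preimage, hre] using ha)
    simpa only [hre] using this
  · have := h3 a b (t.re, t.im) (norm_one_subset_square ht)
      (by simpa only [mem_preimage, hre] using ha) (by simpa only [mem_preimage, hre] using hb)
    simpa only [hre] using this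

/-- Suppose that two charts contain affine lines that a change of charts glues, by `t ↦ t⁻¹`, to
a projective line on which the anti-canonical V-bundle has degree `2`.  If the anti-canonical
V-bundle has an `m`-th root, then `m` divides `2`. -/
theorem dvd_two_of_iso (i₀ : Fin n) {i j : ι} (e : ChartChange φ i j) {c : ℂ} (hc : c ≠ 0)
    (hsource : ∀ t : ℂ, ‖t‖ = 1 → coordLine i₀ t ∈ e.toHomeo.source)
    (hmap : ∀ t : ℂ, ‖t‖ = 1 → e.toHomeo (coordLine i₀ t) = coordLine i₀ t⁻¹)
    (hdet : ∀ t : ℂ, ‖t‖ = 1 → (fderiv ℂ e.toHomeo (coordLine i₀ t)).det = c * (t ^ 2)⁻¹)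
    {m : ℕ} (hm : 0 < m) (h : (L.pow m).Iso (canonical φ).dual) : m ∣ 2 := by
  obtain ⟨u, u1, u2, u3⟩ := h
  have huc : ∀ i a, ContinuousOn (u i a ()) (L.dom i a) := fun i a =>
    (u1 i a ()).continuousOn.mono fun x hx => ⟨hx, mem_univ x⟩
  have hu0 : ∀ i a, ∀ x ∈ L.dom i a, u i a () x ≠ 0 := fun i a x hx =>
    u2 i a () x ⟨hx, mem_univ x⟩
  have hue : ∀ {i j} (e : ChartChange φ i j) a b, ∀ x ∈ L.dom i a, x ∈ e.toHomeo.source →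
      e.toHomeo x ∈ L.dom j b →
      u j b () (e.toHomeo x) * L.trans e a b x ^ m = (fderiv ℂ e.toHomeo x).det * u i a () x := by
    intro i j e a b x ha hx hb
    have := u3 i j e a b () () x hx ha (mem_univ _) hb (mem_univ _)
    have h2 : (canonical φ).dual.trans e () () x = (fderiv ℂ e.toHomeo x).det := inv_inv _
    rwa [h2] at this
  have hroot : ∀ i, HasRootFrame (fun a => coordLine i₀ ⁻¹' L.dom i a)
      (fun a b t => L.trans (ChartChange.refl φ i) a b (coordLine i₀ t))
      (fun a t => u i a () (coordLine i₀ t)) m {t | ‖t‖ = 1} := by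
    intro i
    refine L.hasRootFrame_circle i₀ hm i (huc i) (hu0 i) fun a b x ha hb => ?_
    have h1 := hue (ChartChange.refl φ i) a b x ha (mem_univ _) hb
    have h2 : (fderiv ℂ (ChartChange.refl φ i).toHomeo x).det = 1 := by
      have h3 : fderiv ℂ (ChartChange.refl φ i).toHomeo x = ContinuousLinearMap.id ℂ _ :=
        fderiv_id
      rw [h3]
      simp [ContinuousLinearMap.det]
    rwa [h2, one_mul] at h1
  obtain ⟨f, f1, f2, f3⟩ := hroot i
  obtain ⟨k, k1, k2, k3⟩ := hroot j
  simp only [mem_preimage, mem_ofPred_eq] at f1 f2 f3 k1 k2 k3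
  have hinv : ∀ t : ℂ, ‖t‖ = 1 → ‖t⁻¹‖ = 1 := fun t ht => by rw [norm_inv, ht, inv_one]
  choose A hA using fun t => L.cover i (coordLine i₀ t)
  choose B hB using fun t => L.cover j (coordLine i₀ t⁻¹)
  -- `f` and `k` trivialize L over the circles in the two lines, and `H` is the transition function
  -- between them. It is independent of the indices, and its m-th power is the Jacobian determinant
  -- of `e`.
  let H : L.κ i → L.κ j → ℂ → ℂ := fun a b t =>
    k b t⁻¹ * L.trans e a b (coordLine i₀ t) / f a t
  have fne : ∀ a t, ‖t‖ = 1 → coordLine i₀ t ∈ L.dom i a → f a t ≠ 0 := fun a t ht ha h0 => by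
    have := f2 a t ht ha
    rw [h0, zero_pow hm.ne'] at this
    exact hu0 i a _ ha this.symm
  have hH : ∀ a a' b b' t, ‖t‖ = 1 → coordLine i₀ t ∈ L.dom i a → coordLine i₀ t ∈ L.dom i a' →
      coordLine i₀ t⁻¹ ∈ L.dom j b → coordLine i₀ t⁻¹ ∈ L.dom j b' → H a b t = H a' b' t := by
    intro a a' b b' t ht ha ha' hb hb'
    have e1 := f3 a a' t ht ha ha'
    have e2 := k3 b b' t⁻¹ (hinv t ht) hb hb'
    have e3 := L.trans_refl_mul e a a' b ha ha' (hsource t ht) (by rwa [hmap t ht])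
    have e4 := L.mul_trans_refl e a' b b' ha' (hsource t ht) (by rwa [hmap t ht])
      (by rwa [hmap t ht])
    rw [hmap t ht] at e4
    have n1 := fne a t ht ha
    have n2 := fne a' t ht ha'
    simp only [H]
    rw [div_eq_div_iff n1 n2, e3, e4, ← e1, ← e2]
    ring
  refine dvd_two_of_pow_eq hm hc (h := fun t => H (A t) (B t) t) ?_ ?_
  · intro t ht
    have ht0 : t ≠ 0 := norm_ne_zero_iff.1 (by rw [show ‖t‖ = 1 from ht]; exact one_ne_zero)
    have hci : ContinuousAt (fun s : ℂ => s⁻¹) t := continuousAt_inv₀ ht0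
    have hUa : coordLine i₀ ⁻¹' L.dom i (A t) ∈ 𝓝 t :=
      ((L.isOpen_dom i (A t)).preimage (continuous_coordLine i₀)).mem_nhds (hA t)
    have hUb : (fun s : ℂ => coordLine i₀ s⁻¹) ⁻¹' L.dom j (B t) ∈ 𝓝 t :=
      ContinuousAt.preimage_mem_nhds
        (ContinuousAt.comp (continuous_coordLine i₀).continuousAt hci)
        ((L.isOpen_dom j (B t)).mem_nhds (hB t))
    refine (continuousWithinAt_inter (inter_mem hUa hUb)).1 ?_
    have hcont : ContinuousWithinAt (H (A t) (B t)) ({t | ‖t‖ = 1} ∩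
        (coordLine i₀ ⁻¹' L.dom i (A t) ∩ (fun s : ℂ => coordLine i₀ s⁻¹) ⁻¹' L.dom j (B t))) t := by
      refine ContinuousWithinAt.div (ContinuousWithinAt.mul ?_ ?_) ?_ (fne _ t ht (hA t))
      · exact ContinuousWithinAt.comp (k1 (B t) t⁻¹ ⟨hinv t ht, hB t⟩) hci.continuousWithinAt
          fun s hs => ⟨hinv s hs.1, hs.2.2⟩
      · refine ContinuousWithinAt.comp ((L.holo e (A t) (B t)).continuousOn _ ?_)
          (continuous_coordLine i₀).continuousWithinAt fun s hs => ?_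
        · exact ⟨hA t, hsource t ht, by rw [hmap t ht]; exact hB t⟩
        · exact ⟨hs.2.1, hsource s hs.1, by rw [hmap s hs.1]; exact hs.2.2⟩
      · exact (f1 (A t) t ⟨ht, hA t⟩).mono fun s hs => ⟨hs.1, hs.2.1⟩
    exact hcont.congr
      (fun s hs => hH _ _ _ _ s hs.1 (hA s) hs.2.1 (hB s) hs.2.2) rfl
  · intro t ht
    have h1 := hue e (A t) (B t) _ (hA t) (hsource t ht) (by rw [hmap t ht]; exact hB t)
    rw [hmap t ht, hdet t ht] at h1
    have h2 := hu0 i (A t) _ (hA t)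
    simp only [H]
    rw [div_pow, mul_pow, k2 _ _ (hinv t ht) (hB t), h1, f2 _ _ ht (hA t), mul_div_cancel_right₀ _ h2]

/-- The anti-canonical V-bundle is a first root of itself. -/
theorem one_mem_antiCanonicalRoots : 1 ∈ antiCanonicalRoots φ := by
  refine ⟨one_pos, (canonical φ).dual, fun _ _ _ _ => 1, fun _ _ _ => analyticOnNhd_const,
    fun _ _ _ _ _ => one_ne_zero, ?_⟩
  intro i j e a b a' b' x _ _ _ _ _
  rw [one_mul, mul_one]
  exact pow_one _

end LineVBundle

/-! ### Frames of complete simplicial symmetric fans -/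

theorem PointedCone.mem_hull_range_basis {n : ℕ} (b : Module.Basis (Fin n) ℝ (Fin n → ℝ))
    (y : Fin n → ℝ) : y ∈ PointedCone.hull ℝ (range b) ↔ ∀ j, 0 ≤ b.repr y j := by
  constructor
  · intro hy
    induction hy using Submodule.span_induction with
    | mem x hx =>
      obtain ⟨i, rfl⟩ := hx
      intro j
      rw [b.repr_self, Finsupp.single_apply]
      split_ifs <;> norm_num
    | zero => simp
    | add x y _ _ hx hy => intro j; simpa using add_nonneg (hx j) (hy j)
    | smul c x _ hx =>
      intro j
      have : b.repr (c • x) j = (c : ℝ) * b.repr x j := by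
        rw [show c • x = (c : ℝ) • x from rfl, map_smul]; rfl
      rw [this]
      exact mul_nonneg c.2 (hx j)
  · intro h
    rw [← b.sum_repr y]
    refine Submodule.sum_mem _ fun j _ => ?_
    exact Submodule.smul_mem _ (⟨b.repr y j, h j⟩ : {c : ℝ // 0 ≤ c})
      (Submodule.subset_span (mem_range_self j))

theorem PointedCone.mem_hull_singleton' {n : ℕ} (v y : Fin n → ℝ) :
    y ∈ PointedCone.hull ℝ {v} ↔ ∃ c : ℝ, 0 ≤ c ∧ c • v = y := by
  rw [PointedCone.hull, Submodule.mem_span_singleton]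
  exact ⟨fun ⟨c, hc⟩ => ⟨c, c.2, hc⟩, fun ⟨c, h0, hc⟩ => ⟨⟨c, h0⟩, hc⟩⟩

/-- The cone spanned by a basis vector is a face of the cone spanned by the basis. -/
theorem isFaceOf_hull_singleton {n : ℕ} (b : Module.Basis (Fin n) ℝ (Fin n → ℝ)) (i : Fin n) :
    IsFaceOf (PointedCone.hull ℝ {b i}) (PointedCone.hull ℝ (range b)) := by
  -- The supporting functional is the sum of all coordinates but the i-th: nonnegative on the cone,
  -- and zero there exactly on the ray through `b i`.
  let ψ : (Fin n → ℝ) →ₗ[ℝ] ℝ := ∑ j ∈ Finset.univ.erase i, b.coord j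
  have hψ : ∀ y, (fun k => ψ (Pi.single k 1)) ⬝ᵥ y = ∑ j ∈ Finset.univ.erase i, b.repr y j := by
    intro y
    have h1 : ψ y = ∑ j ∈ Finset.univ.erase i, b.repr y j := by simp [ψ]
    rw [← h1, LinearMap.pi_apply_eq_sum_univ ψ y, dotProduct]
    refine Finset.sum_congr rfl fun k _ => ?_
    rw [smul_eq_mul, mul_comm]
    congr 2
    ext l
    simp [Pi.single_apply, eq_comm]
  refine ⟨fun k => ψ (Pi.single k 1), fun y hy => ?_, fun y => ?_⟩
  · rw [hψ]
    exact Finset.sum_nonneg fun j _ => (PointedCone.mem_hull_range_basis b y).1 hy j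
  · rw [hψ, PointedCone.mem_hull_singleton', PointedCone.mem_hull_range_basis]
    constructor
    · rintro ⟨c, hc, rfl⟩
      refine ⟨fun j => ?_, Finset.sum_eq_zero fun j hj => ?_⟩
      · rw [map_smul, b.repr_self, Finsupp.smul_apply, Finsupp.single_apply, smul_eq_mul]
        split_ifs <;> simp [hc]
      · rw [map_smul, b.repr_self, Finsupp.smul_apply,
          Finsupp.single_eq_of_ne (Finset.ne_of_mem_erase hj), smul_zero]
    · rintro ⟨h1, h2⟩
      rw [Finset.sum_eq_zero_iff_of_nonneg fun j _ => h1 j] at h2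
      refine ⟨b.repr y i, h1 i, ?_⟩
      have h3 : ∑ j, b.repr y j • b j = b.repr y i • b i := by
        refine Finset.sum_eq_single i (fun j _ hj => ?_) fun h => absurd (Finset.mem_univ i) h
        rw [h2 j (Finset.mem_erase.2 ⟨hj, Finset.mem_univ j⟩), zero_smul]
      rw [← h3, b.sum_repr]

theorem coneDim_hull {n : ℕ} (s : Set (Fin n → ℝ)) :
    coneDim (PointedCone.hull ℝ s) = Module.finrank ℝ (Submodule.span ℝ s) := by
  have h : Submodule.span ℝ ((PointedCone.hull ℝ s : PointedCone ℝ (Fin n → ℝ)) :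
      Set (Fin n → ℝ)) = Submodule.span ℝ s := by
    refine le_antisymm (Submodule.span_le.2 fun x hx => ?_)
      (Submodule.span_mono Submodule.subset_span)
    induction hx using Submodule.span_induction with
    | mem x hx => exact Submodule.subset_span hx
    | zero => exact Submodule.zero_mem _
    | add x y _ _ hx hy => exact Submodule.add_mem _ hx hy
    | smul c x _ hx => exact Submodule.smul_mem _ (c : ℝ) hx
  rw [coneDim, h]

theorem glR_neg_one {n : ℕ} : glR (-1 : GL (Fin n) ℤ) = -LinearMap.id := by
  ext i j
  simp [glR, Matrix.map_neg]

namespace AugmentedFan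

variable {n : ℕ} {Δ : AugmentedFan n}

/-- A complete fan has a cone of full dimension. -/
theorem IsComplete.exists_coneDim_eq (h : Δ.IsComplete) : ∃ σ ∈ Δ.cones, coneDim σ = n := by
  by_contra! hne
  -- Finitely many proper subspaces cannot cover a real vector space, so the span of some cone is
  -- everything.
  have h1 := Subspace.biUnion_ne_univ_of_top_notMem
    (s := (Δ.finite.image fun σ : PointedCone ℝ (Fin n → ℝ) => Submodule.span ℝ (σ : Set (Fin n → ℝ))).toFinset) (by
      rw [Set.Finite.mem_toFinset]
      rintro ⟨σ, hσ, htop⟩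
      refine hne σ hσ ?_
      simp only at htop
      rw [coneDim, htop]
      simp)
  refine h1 (eq_univ_of_forall fun x => ?_)
  obtain ⟨σ, hσ, hx⟩ := h x
  refine mem_iUnion₂.2 ⟨Submodule.span ℝ (σ : Set (Fin n → ℝ)), ?_, Submodule.subset_span hx⟩
  simpa using ⟨σ, hσ, rfl⟩

/-- A complete simplicial toric orbifold has a uniformizing chart. -/
theorem nonempty_frame (hcomplete : Δ.IsComplete) (hsimplicial : Δ.IsSimplicial) :
    Nonempty Δ.Frame := by
  obtain ⟨σ, hσ, hdim⟩ := hcomplete.exists_coneDim_eq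
  obtain ⟨p, hp, rfl⟩ := hsimplicial σ hσ hdim
  have hspan : ⊤ ≤ Submodule.span ℝ (range fun i => latR (p i)) :=
    (hp.span_eq_top_of_card_eq_finrank' (by simp)).ge
  let b := Module.Basis.mk hp hspan
  have hb : ⇑b = fun i => latR (p i) := Module.Basis.coe_mk hp hspan
  have hray : ∀ i, PointedCone.hull ℝ {latR (p i)} ∈ Δ.cones ∧
      coneDim (PointedCone.hull ℝ {latR (p i)}) = 1 := by
    intro i
    refine ⟨Δ.face_mem _ hσ _ ?_, ?_⟩
    · have := isFaceOf_hull_singleton b i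
      rwa [hb] at this
    · rw [coneDim_hull, finrank_span_singleton (hp.ne_zero i)]
  let ray : Fin n → Δ.Ray := fun i => ⟨_, hray i⟩
  -- The augmentation may choose a lattice point other than `p i` on the same ray; positive
  -- rescaling preserves independence and the cone.
  have hgen : ∀ i, ∃ c : ℝ, 0 < c ∧ c • latR (p i) = latR (Δ.gen (ray i)) := by
    intro i
    obtain ⟨c, hc, h⟩ := (PointedCone.mem_hull_singleton' _ _).1 (Δ.gen_mem (ray i))
    refine ⟨c, hc.lt_of_ne fun h0 => Δ.gen_ne_zero (ray i) ?_, h⟩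
    rw [← h0, zero_smul] at h
    ext j
    have := congrFun h j
    simp only [latR, Pi.zero_apply] at this
    exact_mod_cast this.symm
  choose c hc hcp using hgen
  refine ⟨⟨ray, ?_, ?_⟩⟩
  · have := hp.units_smul fun i => Units.mk0 (c i) (hc i).ne'
    convert this using 2 with i
    exact (hcp i).symm
  · convert hσ using 1
    refine le_antisymm (Submodule.span_le.2 ?_) (Submodule.span_le.2 ?_)
    · rintro _ ⟨i, rfl⟩
      simp only
      rw [← hcp i]
      exact Submodule.smul_mem _ (⟨c i, (hc i).le⟩ : {c : ℝ // 0 ≤ c})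
        (Submodule.subset_span (mem_range_self i))
    · rintro _ ⟨i, rfl⟩
      have h1 : latR (p i) = (c i)⁻¹ • latR (Δ.gen (ray i)) := by
        rw [← hcp i, inv_smul_smul₀ (hc i).ne']
      simp only
      rw [h1]
      exact Submodule.smul_mem _ (⟨(c i)⁻¹, (inv_pos.2 (hc i)).le⟩ : {c : ℝ // 0 ≤ c})
        (Submodule.subset_span ⟨i, rfl⟩)

/-- In a symmetric fan, every frame has an opposite frame. -/
theorem Frame.exists_neg (hsymm : (-1 : GL (Fin n) ℤ) ∈ Δ.symmetryGroup) (F : Δ.Frame) :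
    ∃ G : Δ.Frame, ∀ i, Δ.gen (G.ray i) = -Δ.gen (F.ray i) := by
  obtain ⟨h1, h2⟩ := hsymm
  let ray : Fin n → Δ.Ray := fun i =>
    ⟨(F.ray i).1.map (glR (-1)), (h1 _).2 (F.ray i).2.1,
      (coneDim_map_glR _ _).trans (F.ray i).2.2⟩
  have hgen : ∀ i, Δ.gen (ray i) = -Δ.gen (F.ray i) := fun i => by
    rw [h2 (F.ray i) (ray i) rfl, Units.val_neg, Units.val_one, Matrix.neg_mulVec,
      Matrix.one_mulVec]
  have hlat : ∀ i, latR (Δ.gen (ray i)) = glR (-1) (latR (Δ.gen (F.ray i))) := fun i => by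
    rw [hgen, glR_neg_one]
    ext j
    simp [latR]
  refine ⟨⟨ray, ?_, ?_⟩, hgen⟩
  · simp only [hlat]
    refine F.indep.map' (glR (-1)) (LinearMap.ker_eq_bot.2 ?_)
    rw [glR_neg_one]
    exact neg_injective
  · convert (h1 _).2 F.cone_mem using 1
    simp only [hlat]
    rw [PointedCone.map, PointedCone.hull, PointedCone.hull, Submodule.map_span, ← range_comp]
    rfl

/-- Inverting the coordinates and negating the generators cancel in every monomial: z_i^⟨m, p_i⟩ =
(z_i⁻¹)^⟨m, −p_i⟩. -/
theorem chart_inv_eq {F G : Δ.Frame} (h : ∀ i, Δ.gen (G.ray i) = -Δ.gen (F.ray i))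
    {z : Fin n → ℂ} (hz : ∀ i, z i ≠ 0) : Δ.chart G (fun i => (z i)⁻¹) = Δ.chart F z := by
  refine (Quot.sound ?_).symm
  -- The gluing witness is a torus point. Integer exponents are needed, since on the dual monoid of
  -- the intersection of the two cones the pairings may be negative; on that of either cone they
  -- agree with the `toNat` exponents of the chart.
  refine ⟨⟨⟨fun m => ∏ i, z i ^ ((m.toAdd : Fin n → ℤ) ⬝ᵥ Δ.gen (F.ray i)), by simp⟩,
    fun a b => ?_⟩, ?_, ?_⟩
  · simp only
    rw [← Finset.prod_mul_distrib]
    refine Finset.prod_congr rfl fun i _ => ?_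
    rw [← zpow_add₀ (hz i)]
    simp [add_dotProduct]
  · refine MonoidHom.ext fun m => ?_
    change ∏ i, z i ^ ((m.toAdd : Fin n → ℤ) ⬝ᵥ Δ.gen (F.ray i)) =
      ∏ i, z i ^ ((m.toAdd : Fin n → ℤ) ⬝ᵥ Δ.gen (F.ray i)).toNat
    refine Finset.prod_congr rfl fun i _ => ?_
    have h1 := F.pairing_nonneg m.toAdd i
    rw [← zpow_natCast, Int.toNat_of_nonneg h1]
  · refine MonoidHom.ext fun m => ?_
    change ∏ i, z i ^ ((m.toAdd : Fin n → ℤ) ⬝ᵥ Δ.gen (F.ray i)) =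
      ∏ i, (z i)⁻¹ ^ ((m.toAdd : Fin n → ℤ) ⬝ᵥ Δ.gen (G.ray i)).toNat
    refine Finset.prod_congr rfl fun i _ => ?_
    have h1 := G.pairing_nonneg m.toAdd i
    rw [← zpow_natCast, Int.toNat_of_nonneg h1, h i, dotProduct_neg, _root_.inv_zpow', neg_neg]

end AugmentedFan

/-! ### Inversion as a change of charts, and the conclusion -/

/-- Coordinatewise inversion on `(ℂ∖0)ⁿ`. -/
noncomputable def torusInv (n : ℕ) : OpenPartialHomeomorph (Fin n → ℂ) (Fin n → ℂ) where
  toFun z i := (z i)⁻¹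
  invFun z i := (z i)⁻¹
  source := {z | ∀ i, z i ≠ 0}
  target := {z | ∀ i, z i ≠ 0}
  map_source' z hz i := inv_ne_zero (hz i)
  map_target' z hz i := inv_ne_zero (hz i)
  left_inv' z _ := funext fun i => inv_inv (z i)
  right_inv' z _ := funext fun i => inv_inv (z i)
  open_source := by
    simp only [ofPred_forall]
    exact isOpen_iInter_of_finite fun i => isOpen_ne_fun (continuous_apply i) continuous_const
  open_target := by
    simp only [ofPred_forall]
    exact isOpen_iInter_of_finite fun i => isOpen_ne_fun (continuous_apply i) continuous_const
  continuousOn_toFun := continuousOn_pi.2 fun i =>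
    (continuous_apply i).continuousOn.inv₀ fun z hz => hz i
  continuousOn_invFun := continuousOn_pi.2 fun i =>
    (continuous_apply i).continuousOn.inv₀ fun z hz => hz i

theorem analyticOnNhd_torusInv (n : ℕ) :
    AnalyticOnNhd ℂ (fun (z : Fin n → ℂ) i => (z i)⁻¹) {z | ∀ i, z i ≠ 0} := by
  intro z hz
  refine AnalyticAt.pi fun i => ?_
  exact ((ContinuousLinearMap.proj (R := ℂ) (φ := fun _ : Fin n => ℂ) i).analyticAt z).inv (hz i)

theorem det_fderiv_torusInv {n : ℕ} {z : Fin n → ℂ} (hz : ∀ i, z i ≠ 0) :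
    (fderiv ℂ (torusInv n) z).det = ∏ i, -(z i ^ 2)⁻¹ := by
  have h : HasFDerivAt (torusInv n) (ContinuousLinearMap.pi fun i =>
      (-(z i ^ 2)⁻¹) • ContinuousLinearMap.proj (R := ℂ) (φ := fun _ : Fin n => ℂ) i) z := by
    refine hasFDerivAt_pi.2 fun i => ?_
    exact (hasDerivAt_inv (hz i)).comp_hasFDerivAt z
      (ContinuousLinearMap.proj (R := ℂ) (φ := fun _ : Fin n => ℂ) i).hasFDerivAt
  rw [h.fderiv, ContinuousLinearMap.det, ← LinearMap.det_toMatrix', ← Matrix.det_diagonal]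
  congr 1
  ext i j
  simp only [LinearMap.toMatrix'_apply, Matrix.diagonal_apply]
  by_cases h : i = j <;> simp [h]

/-- The change of charts `z ↦ z⁻¹` between opposite frames. -/
noncomputable def AugmentedFan.Frame.negChange {n : ℕ} {Δ : AugmentedFan n} {F G : Δ.Frame}
    (h : ∀ i, Δ.gen (G.ray i) = -Δ.gen (F.ray i)) : ChartChange Δ.chart F G where
  toHomeo := torusInv n
  holo := analyticOnNhd_torusInv n
  holo_symm := analyticOnNhd_torusInv n
  proj_eq _ hz := AugmentedFan.chart_inv_eq h hz

theorem mainTheorem10 {n : ℕ} (hn : 1 ≤ n) (Δ : AugmentedFan n)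
    (hcomplete : Δ.IsComplete) (hsimplicial : Δ.IsSimplicial) (hFano : Δ.IsFano)
    (hsymm : (-1 : GL (Fin n) ℤ) ∈ Δ.symmetryGroup) :
    IsGreatest (antiCanonicalRoots Δ.chart) (orbifoldIndex Δ.chart) ∧
      (orbifoldIndex Δ.chart = 1 ∨ orbifoldIndex Δ.chart = 2) := by
  obtain ⟨F⟩ := AugmentedFan.nonempty_frame hcomplete hsimplicial
  obtain ⟨G, hG⟩ := F.exists_neg hsymm
  let i₀ : Fin n := ⟨0, hn⟩
  have hne : ∀ t : ℂ, ‖t‖ = 1 → ∀ i, coordLine i₀ t i ≠ 0 := fun t ht i => by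
    have ht0 : t ≠ 0 := norm_ne_zero_iff.1 (by rw [ht]; exact one_ne_zero)
    unfold coordLine
    split_ifs
    exacts [ht0, one_ne_zero]
  have hdvd : ∀ m ∈ antiCanonicalRoots Δ.chart, m ∣ 2 := by
    rintro m ⟨hm, L, hL⟩
    -- The constant is (−1)ⁿ: each coordinate contributes −z_i⁻² to the Jacobian, which is −1
    -- wherever z_i = 1.
    refine L.dvd_two_of_iso i₀ (AugmentedFan.Frame.negChange hG) (c := ∏ _i : Fin n, (-1 : ℂ))
      (Finset.prod_ne_zero_iff.2 fun _ _ => by norm_num) hne (fun t _ => ?_) (fun t ht => ?_) hm hL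
    · funext i
      change (coordLine i₀ t i)⁻¹ = coordLine i₀ t⁻¹ i
      unfold coordLine
      split_ifs <;> simp
    · refine (det_fderiv_torusInv (hne t ht)).trans ?_
      have : ∀ i, -(coordLine i₀ t i ^ 2)⁻¹ = -1 * if i = i₀ then (t ^ 2)⁻¹ else 1 := fun i => by
        unfold coordLine
        split_ifs <;> simp
      simp only [this]
      rw [Finset.prod_mul_distrib, Finset.prod_ite_eq' Finset.univ i₀, if_pos (Finset.mem_univ _)]
  have hbdd : BddAbove (antiCanonicalRoots Δ.chart) :=
    ⟨2, fun m hm => Nat.le_of_dvd two_pos (hdvd m hm)⟩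
  have hmem : orbifoldIndex Δ.chart ∈ antiCanonicalRoots Δ.chart :=
    Nat.sSup_mem ⟨1, LineVBundle.one_mem_antiCanonicalRoots⟩ hbdd
  exact ⟨⟨hmem, fun m hm => le_csSup hbdd hm⟩, (Nat.dvd_prime Nat.prime_two).1 (hdvd _ hmem)⟩
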